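/- Let $(A,\mathfrak m)$ be a Noetherian local ring of prime characteristic $p>0$ (for instance an excellent reduced one), let $d=\dim A$, and let $\ell_A$ denote length. For an ideal $I$ of $A$ and $q=p^e$ let $I^{[q]}$ be the ideal generated by $\{a^q : a\in I\}$. Let ${}^eA$ be the ring $A$ viewed as an $A$-algebra via $a\mapsto a^{p^e}$; for an $A$-module $M$ put $\mathbf F^e_A(M)={}^eA\otimes_A M$, regarded as an $A$-module by multiplication on the first factor, and for $x\in M$ put $F^e_A(x)=1\otimes x\in\mathbf F^e_A(M)$. Let $E$ be an injective hull of the residue field $A/\mathfrak m$, let $z$ be a generator of its socle $\operatorname{Soc}(E)=\{x\in E : \mathfrak m x=0\}$, and put $$ \operatorname{m_{HK}}(A)=\liminf_{e\to\infty}\frac{\ell_A\bigl(A/\operatorname{ann}_A F^e_A(z)\bigr)}{p^{ed}}, \qquad \operatorname{rel.m_{HK}}(A)=\inf_{I\subseteq I',\ \ell_A(I'/I)=1}\ \liminf_{e\to\infty}\frac{\ell_A\bigl(I'^{[p^e]}/I^{[p^e]}\bigr)}{p^{ed}}, $$ where the infimum is over all pairs of ideals $I\subseteq I'$ of $A$ with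 $\ell_A(I'/I)=1$. Then $$\operatorname{rel.m_{HK}}(A)\ \ge\ \operatorname{m_{HK}}(A).$$ In particular, for all $\mathfrak m$-primary ideals $I\subseteq I'$ with $\ell_A(I'/I)=1$, the limit inferior of $\ell_A(I'^{[q]}/I^{[q]})/q^d$ over $q=p^e$ is at least $\operatorname{m_{HK}}(A)$. -/

import Mathlib

open scoped ENNReal TensorProduct
open Filter

universe u

namespace MinimalHK

/-! ### Injective hulls -/

/-- `ι : M → E` is an injective hull of `M`: the module `E` is injective, `ι` is injective, and
`E` is an essential extension of the image of `ι`. -/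
structure IsInjectiveHull {A M E : Type u} [CommRing A] [AddCommGroup M] [Module A M]
    [AddCommGroup E] [Module A E] (ι : M →ₗ[A] E) : Prop where
  injective_module : Module.Injective A E
  injective_map : Function.Injective ι
  essential : ∀ N : Submodule A E, N ⊓ LinearMap.range ι = ⊥ → N = ⊥

/-- The socle `{x ∈ E | 𝔪 x = 0}` of a module `E` over a local ring `(A, 𝔪)`. -/
def socle (A E : Type u) [CommRing A] [IsLocalRing A] [AddCommGroup E] [Module A E] :
    Submodule A E where
  carrier := {x | ∀ r ∈ IsLocalRing.maximalIdeal A, r • x = 0}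
  add_mem' hx hy r hr := by rw [smul_add, hx r hr, hy r hr, add_zero]
  zero_mem' r _ := smul_zero r
  smul_mem' c x hx r hr := by rw [smul_comm, hx r hr, smul_zero]

/-- Every module has an injective hull. -/
theorem exists_isInjectiveHull (A M : Type u) [CommRing A] [AddCommGroup M] [Module A M] :
    ∃ (E : Type u) (_ : AddCommGroup E) (_ : Module A E) (ι : M →ₗ[A] E), IsInjectiveHull ι := by
  have pres := (CategoryTheory.EnoughInjectives.presentation (ModuleCat.of A M)).some
  obtain ⟨J, hJ, f, hf⟩ : ∃ (J : ModuleCat.{u} A) (_ : CategoryTheory.Injective J)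
      (f : ModuleCat.of A M ⟶ J), CategoryTheory.Mono f :=
    ⟨pres.J, pres.injective, pres.f, pres.mono⟩
  have hJi : Module.Injective A J := (Module.injective_iff_injective_object A J).2 hJ
  have hfi : Function.Injective f.hom := (ModuleCat.mono_iff_injective f).1 hf
  let S : Submodule A J := LinearMap.range f.hom
  let P : Set (Submodule A J) := {N | S ≤ N ∧ ∀ x ∈ N, x ≠ 0 → ∃ r : A, r • x ∈ S ∧ r • x ≠ 0}
  have hSP : S ∈ P := ⟨le_rfl, fun x hx h0 => ⟨1, by simpa using hx, by simpa using h0⟩⟩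
  obtain ⟨E, hSE, hE⟩ := zorn_le_nonempty₀ P (by
    intro c hc hchain N hN
    refine ⟨sSup c, ⟨(hc hN).1.trans (le_sSup hN), ?_⟩, fun z hz => le_sSup hz⟩
    intro x hx h0
    obtain ⟨N', hN', hx'⟩ := (Submodule.mem_sSup_of_directed ⟨N, hN⟩ hchain.directedOn).1 hx
    exact (hc hN').2 x hx' h0) S hSP
  let Q : Set (Submodule A J) := {K | ∀ x ∈ K, x ∈ E → x = 0}
  obtain ⟨K, -, hK⟩ := zorn_le_nonempty₀ Q (by
    intro c hc hchain N hN
    refine ⟨sSup c, ?_, fun z hz => le_sSup hz⟩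
    intro x hx hxE
    obtain ⟨N', hN', hx'⟩ := (Submodule.mem_sSup_of_directed ⟨N, hN⟩ hchain.directedOn).1 hx
    exact hc hN' x hx' hxE) ⊥ (fun x hx _ => by simpa using hx)
  have hmeet : ∀ x, x ∉ K → ∃ r : A, ∃ e ∈ E, e ≠ 0 ∧ K.mkQ e = r • K.mkQ x := by
    intro x hx
    by_contra hcon
    push Not at hcon
    have hQ : K ⊔ Submodule.span A {x} ∈ Q := by
      intro y hy hyE
      obtain ⟨k, hk, w, hw, rfl⟩ := Submodule.mem_sup.1 hy
      obtain ⟨r, rfl⟩ := Submodule.mem_span_singleton.1 hw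
      by_contra hne
      refine hcon r _ hyE hne ?_
      have hk0 : K.mkQ k = 0 := by simpa using hk
      rw [map_add, hk0, zero_add, map_smul]
    exact hx (hK.le_of_ge hQ le_sup_left
      (Submodule.mem_sup_right (Submodule.mem_span_singleton_self x)))
  have hg : Function.Injective (K.mkQ ∘ₗ E.subtype) := by
    rw [injective_iff_map_eq_zero]
    rintro ⟨e, he⟩ h
    have : e ∈ K := by simpa using h
    simpa using hK.prop e this he
  obtain ⟨h, hh⟩ := hJi.out (K.mkQ ∘ₗ E.subtype) hg E.subtype
  have hh' : ∀ e ∈ E, h (K.mkQ e) = e := fun e he => hh ⟨e, he⟩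
  have hstep : ∀ y : J ⧸ K, y ≠ 0 → ∃ r : A, r • h y ∈ E ∧ r • h y ≠ 0 := by
    intro y hy
    obtain ⟨x, rfl⟩ := K.mkQ_surjective y
    obtain ⟨r, e, he, h0, hre⟩ := hmeet x (by simpa using hy)
    refine ⟨r, ?_⟩
    rw [← map_smul, ← hre, hh' e he]
    exact ⟨he, h0⟩
  have hrange : LinearMap.range h ≤ E := by
    refine hE.le_of_ge (y := LinearMap.range h) ⟨hE.prop.1.trans fun e he => ⟨_, hh' e he⟩, ?_⟩
      fun e he => ⟨_, hh' e he⟩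
    rintro _ ⟨y, rfl⟩ h0
    obtain ⟨r, hr, hr0⟩ := hstep y (by rintro rfl; simp at h0)
    obtain ⟨s, hs, hs0⟩ := hE.prop.2 _ hr hr0
    exact ⟨s * r, by rwa [mul_smul], by rwa [mul_smul]⟩
  let π : J →ₗ[A] E := (h ∘ₗ K.mkQ).codRestrict E fun x => hrange ⟨_, rfl⟩
  have hπ : ∀ e : E, π e = e := fun e => Subtype.ext (hh' e e.2)
  refine ⟨E, inferInstance, inferInstance, f.hom.codRestrict E fun m => hE.prop.1 ⟨m, rfl⟩,
    ⟨⟨fun X Y _ _ _ _ i hi g => ?_⟩, fun a b hab => hfi (congrArg Subtype.val hab), ?_⟩⟩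
  · obtain ⟨l, hl⟩ := hJi.out i hi (E.subtype ∘ₗ g)
    exact ⟨π ∘ₗ l, fun x => by simp [hl, hπ]⟩
  · intro N hN
    refine (Submodule.eq_bot_iff N).2 fun x hx => by_contra fun h0 => ?_
    obtain ⟨r, ⟨m, hm⟩, hr0⟩ := hE.prop.2 x x.2 fun h => h0 (Subtype.ext h)
    have : r • x ∈ N ⊓ LinearMap.range (f.hom.codRestrict E fun m => hE.prop.1 ⟨m, rfl⟩) :=
      ⟨N.smul_mem r hx, m, Subtype.ext hm⟩
    rw [hN] at this
    exact hr0 (congrArg Subtype.val ((Submodule.mem_bot A).1 this))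

/-- Over a local ring with residue field `k`, the injective hull `E` of `k` has a socle generated
by one element. -/
theorem IsInjectiveHull.exists_span_eq_socle {A E : Type u} [CommRing A] [IsLocalRing A]
    [AddCommGroup E] [Module A E] {ι : IsLocalRing.ResidueField A →ₗ[A] E}
    (hι : IsInjectiveHull ι) : ∃ z : E, z ≠ 0 ∧ Submodule.span A {z} = socle A E := by
  have hs : ∀ x : IsLocalRing.ResidueField A, ∃ a : A, x = a • 1 := fun x => by
    obtain ⟨a, rfl⟩ := IsLocalRing.residue_surjective x
    exact ⟨a, by rw [Algebra.smul_def, mul_one]; rfl⟩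
  refine ⟨ι 1, fun h => one_ne_zero (hι.injective_map (h.trans (map_zero ι).symm)),
    le_antisymm ?_ fun x hx => ?_⟩
  · rw [Submodule.span_singleton_le_iff_mem]
    intro r hr
    have : r • (1 : IsLocalRing.ResidueField A) = 0 := by
      rw [Algebra.smul_def, mul_one]
      exact (IsLocalRing.residue_eq_zero_iff r).2 hr
    rw [← map_smul, this, map_zero]
  · by_cases h0 : x = 0
    · simp [h0]
    have hne : Submodule.span A {x} ⊓ LinearMap.range ι ≠ ⊥ := fun h =>
      h0 (Submodule.span_singleton_eq_bot.1 (hι.essential _ h))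
    obtain ⟨y, ⟨hy, w, hw⟩, hy0⟩ := (Submodule.ne_bot_iff _).1 hne
    obtain ⟨r, rfl⟩ := Submodule.mem_span_singleton.1 hy
    have hr : IsUnit r := by
      by_contra hr
      exact hy0 (hx r hr)
    obtain ⟨a, rfl⟩ := hs w
    obtain ⟨v, rfl⟩ := hr
    refine Submodule.mem_span_singleton.2 ⟨(↑v⁻¹ : A) * a, ?_⟩
    rw [mul_smul, ← map_smul, hw, smul_smul, Units.inv_mul, one_smul]

/-! ### The Peskine-Szpiro functor -/

/-- The ring `ᵉA`: the ring `A`, viewed as an `A`-algebra by `Fᵉ : A → A`, `a ↦ a ^ (p ^ e)`. -/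
def FrobeniusTwist (_p _e : ℕ) (A : Type u) : Type u := A

instance (p e : ℕ) (A : Type u) [CommRing A] : CommRing (FrobeniusTwist p e A) :=
  inferInstanceAs (CommRing A)

/-- The identity of `A`, as an isomorphism of rings from `A` to `ᵉA`. -/
def FrobeniusTwist.equiv (p e : ℕ) (A : Type u) [CommRing A] : A ≃+* FrobeniusTwist p e A :=
  RingEquiv.refl A

instance (p e : ℕ) (A : Type u) [CommRing A] [ExpChar A p] : Algebra A (FrobeniusTwist p e A) :=
  ((FrobeniusTwist.equiv p e A).toRingHom.comp (iterateFrobenius A p e)).toAlgebra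

/-- `𝐅ᵉ(M) = ᵉA ⊗_A M`, so that `1 ⊗ a m = a ^ (p ^ e) ⊗ m`. -/
abbrev PeskineSzpiro (p e : ℕ) (A M : Type u) [CommRing A] [ExpChar A p] [AddCommGroup M]
    [Module A M] : Type u :=
  FrobeniusTwist p e A ⊗[A] M

/-- The ideal `ann_A Fᵉ(z)`, where `Fᵉ(z) = 1 ⊗ z ∈ 𝐅ᵉ(M)` and `c ∈ A` acts on `𝐅ᵉ(M)` by
multiplication on the first factor, `c (a ⊗ m) = c a ⊗ m`. -/
def annFrobenius (p e : ℕ) {A M : Type u} [CommRing A] [ExpChar A p] [AddCommGroup M]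
    [Module A M] (z : M) : Ideal A :=
  Ideal.comap (FrobeniusTwist.equiv p e A)
    (LinearMap.ker (LinearMap.toSpanSingleton (FrobeniusTwist p e A) (PeskineSzpiro p e A M)
      (1 ⊗ₜ[A] z)))

/-! ### Hilbert-Kunz type invariants -/

/-- The Frobenius power `I^[q]`, the ideal generated by `{a ^ q | a ∈ I}`. -/
def frobeniusPower {A : Type u} [CommRing A] (I : Ideal A) (q : ℕ) : Ideal A :=
  Ideal.span {x | ∃ a ∈ I, x = a ^ q}

/-- The length `ℓ_A(I' / (I ∩ I'))`, which is `ℓ_A(I' / I)` when `I ⊆ I'`. -/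
noncomputable def quotLength {A : Type u} [CommRing A] (I I' : Ideal A) : ℕ∞ :=
  Module.length A (I' ⧸ Submodule.submoduleOf I I')

/-- The Krull dimension of a nontrivial ring of finite Krull dimension, as a natural number. -/
noncomputable def dim (A : Type u) [CommRing A] : ℕ := ((ringKrullDim A).unbotD 0).toNat

/-- For Noetherian local rings, `dim` is the Krull dimension. -/
theorem coe_dim (A : Type u) [CommRing A] [IsLocalRing A] [IsNoetherianRing A] :
    ((dim A : ℕ∞) : WithBot ℕ∞) = ringKrullDim A := by
  have h1 := ringKrullDim_ne_bot (R := A)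
  have h2 := ringKrullDim_ne_top (R := A)
  unfold dim
  generalize ringKrullDim A = x at *
  cases x with
  | bot => exact absurd rfl h1
  | coe x =>
    have hx : x ≠ ⊤ := by rintro rfl; exact h2 rfl
    rw [WithBot.unbotD_coe, ENat.natCast_toNat hx]

/-- The relative Hilbert-Kunz multiplicity
`e_HK(I, I'; A) = liminf_e ℓ_A(I'^[p^e] / I^[p^e]) / p^(e d)`, where `d = dim A`. -/
noncomputable def relHK (p : ℕ) {A : Type u} [CommRing A] (I I' : Ideal A) : ℝ≥0∞ :=
  liminf (fun e : ℕ => (quotLength (frobeniusPower I (p ^ e)) (frobeniusPower I' (p ^ e)) : ℝ≥0∞) /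
    (p : ℝ≥0∞) ^ (e * dim A)) atTop

/-- The relative minimal Hilbert-Kunz multiplicity
`rel.m_HK(A) = inf {e_HK(I, I'; A) | I ⊆ I', ℓ_A(I' / I) = 1}`. -/
noncomputable def relMinHK (p : ℕ) (A : Type u) [CommRing A] : ℝ≥0∞ :=
  ⨅ (I : Ideal A) (I' : Ideal A) (_ : I ≤ I') (_ : quotLength I I' = 1), relHK p I I'

/-- `liminf_e ℓ_A(A / ann_A Fᵉ(z)) / p^(e d)`, where `d = dim A`. When `z` generates the socle of
the injective hull of the residue field of `A`, this is the minimal Hilbert-Kunz multiplicity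
`m_HK(A)`. -/
noncomputable def minHK (p : ℕ) (A : Type u) {E : Type u} [CommRing A] [ExpChar A p]
    [AddCommGroup E] [Module A E] (z : E) : ℝ≥0∞ :=
  liminf (fun e : ℕ => (Module.length A (A ⧸ annFrobenius p e (A := A) z) : ℝ≥0∞) /
    (p : ℝ≥0∞) ^ (e * dim A)) atTop

end MinimalHK

namespace MinimalHK

/-- If `I ⊆ I'` and `ℓ(I' / I) = 1`, every socle element of an injective module is of the form
`u x` with `u ∈ I'` and `I x = 0`. -/
theorem exists_smul_eq_of_quotLength_eq_one {A E : Type u} [CommRing A] [IsLocalRing A]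
    [AddCommGroup E] [Module A E] (hE : Module.Injective A E) {z : E} (hz : z ∈ socle A E)
    {I I' : Ideal A} (hI : I ≤ I') (hlen : quotLength I I' = 1) :
    ∃ u ∈ I', ∃ x : E, u • x = z ∧ ∀ a ∈ I, a • x = 0 := by
  have hsimple : IsSimpleModule A (I' ⧸ Submodule.submoduleOf I I') :=
    Module.length_eq_one_iff.1 hlen
  obtain ⟨J, hJ, ⟨f⟩⟩ := isSimpleModule_iff_quot_maximal.1 hsimple
  obtain rfl := IsLocalRing.eq_maximalIdeal hJ
  -- The map `1 ↦ z` is well defined because `z` is killed by the maximal ideal.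
  let s : (A ⧸ IsLocalRing.maximalIdeal A) →ₗ[A] E :=
    Submodule.liftQ _ (LinearMap.toSpanSingleton A E z) fun r hr => hz r hr
  let π := Submodule.mkQ (Submodule.submoduleOf I I')
  obtain ⟨⟨u, hu⟩, hπu⟩ := Submodule.mkQ_surjective (Submodule.submoduleOf I I')
    (f.symm (Submodule.Quotient.mk 1))
  -- Being defined on all of `A`, the extension `h` is multiplication by `h 1`, which serves as `x`.
  obtain ⟨h, hh⟩ := hE.out I'.subtype I'.subtype_injective (s ∘ₗ f.toLinearMap ∘ₗ π)
  have hsmul : ∀ a : A, a • h 1 = h a := fun a => by rw [← map_smul, smul_eq_mul, mul_one]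
  refine ⟨u, hu, h 1, ?_, fun a ha => ?_⟩
  · have h1 : h u = s (f (π ⟨u, hu⟩)) := hh ⟨u, hu⟩
    have h2 : f (π ⟨u, hu⟩) = Submodule.Quotient.mk 1 := by
      rw [show π ⟨u, hu⟩ = _ from hπu, f.apply_symm_apply]
    rw [hsmul, h1, h2]
    exact (Submodule.liftQ_apply _ _ _).trans (one_smul A z)
  · have h1 : h a = s (f (π ⟨a, hI ha⟩)) := hh ⟨a, hI ha⟩
    have h2 : π ⟨a, hI ha⟩ = 0 := (Submodule.Quotient.mk_eq_zero _).2 ha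
    rw [hsmul, h1, h2, map_zero, map_zero]

/-- In `𝐅ᵉ(M)`, one has `a ^ (p ^ e) ⊗ x = 1 ⊗ a x`. -/
theorem pow_tmul {A M : Type u} [CommRing A] (p e : ℕ) [ExpChar A p] [AddCommGroup M]
    [Module A M] (a : A) (x : M) :
    FrobeniusTwist.equiv p e A (a ^ p ^ e) ⊗ₜ[A] x =
      (1 : FrobeniusTwist p e A) ⊗ₜ[A] (a • x) := by
  rw [← TensorProduct.smul_tmul, Algebra.smul_def, mul_one]
  rfl

theorem mem_annFrobenius {A M : Type u} [CommRing A] {p e : ℕ} [ExpChar A p] [AddCommGroup M]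
    [Module A M] {z : M} {c : A} :
    c ∈ annFrobenius p e z ↔ FrobeniusTwist.equiv p e A c ⊗ₜ[A] z = 0 := by
  rw [annFrobenius, Ideal.mem_comap, LinearMap.mem_ker, LinearMap.toSpanSingleton_apply,
    TensorProduct.smul_tmul', smul_eq_mul, mul_one]

theorem frobeniusPower_le_annFrobenius {A M : Type u} [CommRing A] (p e : ℕ) [ExpChar A p]
    [AddCommGroup M] [Module A M] {I : Ideal A} {x : M} (hx : ∀ a ∈ I, a • x = 0) :
    frobeniusPower I (p ^ e) ≤ annFrobenius p e x := by
  refine Ideal.span_le.2 ?_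
  rintro _ ⟨a, ha, rfl⟩
  rw [SetLike.mem_coe, mem_annFrobenius, pow_tmul, hx a ha, TensorProduct.tmul_zero]

/-- Moving `u` across the tensor sign turns it into `u ^ (p ^ e)`. -/
theorem mem_annFrobenius_smul {A M : Type u} [CommRing A] {p e : ℕ} [ExpChar A p]
    [AddCommGroup M] [Module A M] {u c : A} {x : M} (h : c * u ^ p ^ e ∈ annFrobenius p e x) :
    c ∈ annFrobenius p e (u • x) := by
  rw [mem_annFrobenius] at h ⊢
  rw [← mul_one (FrobeniusTwist.equiv p e A c), ← smul_eq_mul, ← TensorProduct.smul_tmul',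
    ← pow_tmul, TensorProduct.smul_tmul', smul_eq_mul, ← map_mul, h]

/-- Compares both sides with the cyclic submodule generated by the class of `u ^ (p ^ e)`. Lengths
lie in `ℕ∞`, so `I` need not be primary to the maximal ideal. -/
theorem length_quotient_annFrobenius_le {A M : Type u} [CommRing A] (p e : ℕ) [ExpChar A p]
    [AddCommGroup M] [Module A M] {I I' : Ideal A} {u : A} (hu : u ∈ I') {x : M}
    (hx : ∀ a ∈ I, a • x = 0) :
    Module.length A (A ⧸ annFrobenius p e (u • x)) ≤
      quotLength (frobeniusPower I (p ^ e)) (frobeniusPower I' (p ^ e)) := by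
  let w : frobeniusPower I' (p ^ e) := ⟨u ^ p ^ e, Ideal.subset_span ⟨u, hu, rfl⟩⟩
  let g := LinearMap.toSpanSingleton A _ (Submodule.mkQ
    (Submodule.submoduleOf (frobeniusPower I (p ^ e)) (frobeniusPower I' (p ^ e))) w)
  -- The kernel of `g` is the colon ideal `(I^[q] : u ^ q)`.
  have hker : LinearMap.ker g ≤ annFrobenius p e (u • x) := by
    intro c hc
    rw [LinearMap.mem_ker, LinearMap.toSpanSingleton_apply, ← map_smul] at hc
    have hcw : c • w ∈ Submodule.submoduleOf (frobeniusPower I (p ^ e))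
        (frobeniusPower I' (p ^ e)) := (Submodule.Quotient.mk_eq_zero _).1 hc
    have hcu : c * u ^ p ^ e ∈ frobeniusPower I (p ^ e) := hcw
    exact mem_annFrobenius_smul (frobeniusPower_le_annFrobenius p e hx hcu)
  calc Module.length A (A ⧸ annFrobenius p e (u • x))
      ≤ Module.length A (A ⧸ LinearMap.ker g) :=
        Module.length_le_of_surjective (Submodule.factor hker) (Submodule.factor_surjective hker)
    _ ≤ _ := Module.length_le_of_injective (Submodule.liftQ _ g le_rfl)
        (LinearMap.ker_eq_bot.1 (Submodule.ker_liftQ_eq_bot _ _ _ le_rfl))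

end MinimalHK

theorem proposition1p10 (p : ℕ) [Fact p.Prime] (A : Type u) [CommRing A] [IsLocalRing A]
    [IsNoetherianRing A] [CharP A p] (E : Type u) [AddCommGroup E] [Module A E]
    (ι : IsLocalRing.ResidueField A →ₗ[A] E) (hι : MinimalHK.IsInjectiveHull ι)
    (z : E) (hz : Submodule.span A {z} = MinimalHK.socle A E) :
    MinimalHK.minHK p A z ≤ MinimalHK.relMinHK p A := by
  refine le_iInf fun I => le_iInf fun I' => le_iInf fun hI => le_iInf fun hlen => ?_
  obtain ⟨u, hu, x, rfl, hx⟩ := MinimalHK.exists_smul_eq_of_quotLength_eq_one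
    hι.injective_module (hz ▸ Submodule.mem_span_singleton_self z) hI hlen
  -- The bound is termwise in `e`, with the same denominator on both sides.
  exact liminf_le_liminf (Eventually.of_forall fun e => ENNReal.div_le_div_right
    (ENat.toENNReal_le.2 (MinimalHK.length_quotient_annFrobenius_le p e hu hx)) _)
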